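/- Define the Lucas numbers by $L_0=2$, $L_1=1$ and $L_k=L_{k-1}+L_{k-2}$ for $k\ge 2$. Call a binary string of length $n$ run-constrained-circularly if, when the string is read in a circular manner, every run (maximal sequence of contiguous equal bits) of 1s is immediately followed by a strictly longer run of 0s (in particular, the all-ones string of positive length is excluded). The associated Mersenne graph $\mathcal{M}_n$ has as vertices all run-constrained-circularly binary strings of length $n$, two of them being adjacent if and only if their Hamming distance is $1$. Then, for every integer $n\ge 4$, $$|E(\mathcal{M}_n)| = n\,L_{n-3}.$$ -/

import Mathlib

/-- The Lucas numbers: `L 0 = 2`, `L 1 = 1`, `L (k + 2) = L (k + 1) + L k`. -/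
def lucasNumber : ℕ → ℕ
  | 0 => 2
  | 1 => 1
  | k + 2 => lucasNumber (k + 1) + lucasNumber k

/-- Binary strings of length `n`; `true` is the bit `1`, `false` is the bit `0`. -/
abbrev BinaryString (n : ℕ) : Type := Fin n → Bool

/-- The position reached from `s` by moving `k` places to the right, cyclically modulo `n`. -/
def cyclicShift {n : ℕ} (s : Fin n) (k : ℕ) : Fin n :=
  ⟨(s.val + k) % n, Nat.mod_lt _ s.pos⟩

/-- The string `b`, read in a circular manner, has a run of the bit `c` (a non-extendable sequence
of contiguous bits `c`) that starts at position `s` and has length `l`. Such a run either is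
the whole circle or has the other bit at both neighbouring positions; the position before `s` is
`cyclicShift s (n - 1)`. -/
def IsCircularRun {n : ℕ} (b : BinaryString n) (c : Bool) (s : Fin n) (l : ℕ) : Prop :=
  1 ≤ l ∧ l ≤ n ∧ (∀ j < l, b (cyclicShift s j) = c) ∧
    (l = n ∨ (b (cyclicShift s (n - 1)) ≠ c ∧ b (cyclicShift s l) ≠ c))

/-- Every circular run of 1s is immediately followed by a strictly longer run of 0s. -/
def RunConstrainedCircularly {n : ℕ} (b : BinaryString n) : Prop :=
  ∀ (s : Fin n) (k : ℕ), IsCircularRun b true s k →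
    ∃ m, k < m ∧ IsCircularRun b false (cyclicShift s k) m

/-- The hypercube `Q_n`: binary strings of length `n`, adjacent at Hamming distance 1. -/
def hypercube (n : ℕ) : SimpleGraph (BinaryString n) where
  Adj a b := hammingDist a b = 1
  symm := ⟨fun a b h => by rw [hammingDist_comm]; exact h⟩
  loopless := ⟨fun a h => by simp at h⟩

/-- The associated Mersenne graph: the subgraph of the hypercube induced by the strings that are
run-constrained in a circular manner. -/
def associatedMersenneGraph (n : ℕ) :
    SimpleGraph {b : BinaryString n | RunConstrainedCircularly b} :=
  (hypercube n).induce {b | RunConstrainedCircularly b}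

/-! Orient each edge from its endpoint with more ones: edges become pairs of a position `i` and a
valid string with a one at `i` that may be cleared. Rotation makes the count independent of `i`,
giving the factor `n`. Clearing a one keeps the string valid exactly when it is at an end of its run
(`runConstrainedCircularly_flip_one`).

Write `a m` for `acceptCount true 1 m`. Ones that start a run contribute `a (n - 1)`, and by
rotation so do ones that end a run; a one that ends its run without starting it is counted once.
Hence the total is that of ones followed by a zero, `a (n - 1)`, plus that of patterns `011`, `a (n
- 3)`. Cutting the circle before a run turns these into counts of words of blocks `1^a 0^b` with `a
< b`; `a` obeys the Fibonacci recurrence, and the sum is a Lucas number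
(`acceptCount_add_eq_lucasNumber`). -/

/-- The `n`-periodic sequence obtained by reading `b` around the circle. -/
def unroll {n : ℕ} [NeZero n] (b : BinaryString n) (i : ℕ) : Bool := b (Fin.ofNat n i)

/-- Each block of `k` ones that is followed by a zero is followed by at least `k + 1` zeros. -/
def Constrained (f : ℕ → Bool) : Prop :=
  ∀ s k, 1 ≤ k → (∀ j < k, f (s + j) = true) → f (s + k) = false →
    ∀ j ≤ k, f (s + k + j) = false

theorem unroll_add_self {n : ℕ} [NeZero n] (b : BinaryString n) (i : ℕ) :
    unroll b (i + n) = unroll b i := by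
  unfold unroll; congr 1; ext; simp

theorem unroll_mod {n : ℕ} [NeZero n] (b : BinaryString n) (i : ℕ) :
    unroll b (i % n) = unroll b i := by
  unfold unroll; congr 1; ext; simp

theorem unroll_congr {n : ℕ} [NeZero n] (b : BinaryString n) {i j : ℕ} (h : i % n = j % n) :
    unroll b i = unroll b j := by
  rw [← unroll_mod, h, unroll_mod]

theorem unroll_val {n : ℕ} [NeZero n] (b : BinaryString n) (i : Fin n) :
    unroll b i = b i := by
  unfold unroll; congr 1; ext; simp

theorem apply_cyclicShift {n : ℕ} [NeZero n] (b : BinaryString n) (s : Fin n) (j : ℕ) :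
    b (cyclicShift s j) = unroll b (s + j) := rfl

theorem unroll_cyclicShift {n : ℕ} [NeZero n] (b : BinaryString n) (s : Fin n) (k j : ℕ) :
    b (cyclicShift (cyclicShift s k) j) = unroll b (s + k + j) := by
  rw [apply_cyclicShift b]
  apply unroll_congr
  simp [cyclicShift]

/-- Every window of `n` consecutive positions meets each value of a periodic sequence. -/
theorem exists_unroll_in_window {n : ℕ} [NeZero n] (b : BinaryString n) (c : Bool) (i p : ℕ)
    (h : unroll b i = c) : ∃ j < n, unroll b (p + j) = c := by
  have hn := NeZero.pos n
  refine ⟨(i + (n - p % n)) % n, Nat.mod_lt _ hn, ?_⟩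
  rw [← h]
  apply unroll_congr
  have h1 := Nat.mod_lt p hn
  have h2 := Nat.div_add_mod p n
  rw [Nat.add_mod_mod]
  have : p + (i + (n - p % n)) = i + n * (p / n + 1) := by
    rw [mul_add]; omega
  rw [this, Nat.add_mul_mod_self_left]

/-- `Constrained` also tests non-maximal blocks, but extending a block to the left up to its full
run only asks for more zeros. The existence of a zero rules out the all-ones circle. -/
theorem runConstrainedCircularly_iff {n : ℕ} [NeZero n] (b : BinaryString n) :
    RunConstrainedCircularly b ↔ (∃ i, unroll b i = false) ∧ Constrained (unroll b) := by
  have hn := NeZero.pos n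
  constructor
  · intro h
    have hz : ∃ i, unroll b i = false := by
      by_contra! hc
      obtain ⟨m, hm, hr⟩ := h ⟨0, hn⟩ n
        ⟨hn, le_rfl, fun j _ => by rw [apply_cyclicShift b]; simpa using hc _, Or.inl rfl⟩
      exact absurd hr.2.1 (by omega)
    refine ⟨hz, fun s k hk hones hzero => ?_⟩
    obtain ⟨i, hi⟩ := hz
    -- The least such `d` is the number of ones just before `s`; adding the period `n` keeps the
    -- subtraction from truncating.
    have hex : ∃ d, unroll b (s + n - 1 - d) = false := by
      obtain ⟨j, hj, hj'⟩ := exists_unroll_in_window b false i s hi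
      exact ⟨n - 1 - j, by rw [← hj']; congr 1; omega⟩
    classical
    let d := Nat.find hex
    have hd : unroll b (s + n - 1 - d) = false := Nat.find_spec hex
    have hdn : d < n := by
      obtain ⟨j, hj, hj'⟩ := exists_unroll_in_window b false i s hi
      have : d ≤ n - 1 - j := Nat.find_min' hex (by rw [← hj']; congr 1; omega)
      omega
    have hlt : ∀ e < d, unroll b (s + n - 1 - e) = true := fun e he => by
      simpa using Nat.find_min hex he
    have hrun : ∀ j < d + k, unroll b (s + n - d + j) = true := by
      intro j hj
      by_cases hjd : j < d
      · rw [← hlt (d - 1 - j) (by omega)]; congr 1; omega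
      · rw [← hones (j - d) (by omega), ← unroll_add_self b (s + (j - d))]; congr 1; omega
    have hlen : d + k ≤ n := by
      by_contra! hc
      obtain ⟨j, hj, hj'⟩ := exists_unroll_in_window b false i (s + n - d) hi
      rw [hrun j (by omega)] at hj'
      exact absurd hj' (by simp)
    obtain ⟨m, hm, hr⟩ := h (Fin.ofNat n (s + n - d)) (d + k) ⟨by omega, hlen, fun j hj => by
        rw [apply_cyclicShift b, ← hrun j hj]; apply unroll_congr; simp, Or.inr ⟨by
        rw [apply_cyclicShift b, ne_eq, Bool.not_eq_true, ← hd, ← unroll_add_self b (s + n - 1 - d)]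
        apply unroll_congr
        rw [Fin.val_ofNat, Nat.mod_add_mod]; congr 1; omega, by
        rw [apply_cyclicShift b, ne_eq, Bool.not_eq_true, ← hzero, ← unroll_add_self b (s + k)]
        apply unroll_congr
        rw [Fin.val_ofNat, Nat.mod_add_mod]; congr 1; omega⟩⟩
    intro j hj
    rw [← hr.2.2.1 j (by omega), unroll_cyclicShift b, ← unroll_add_self b (s + k + j)]
    apply unroll_congr
    rw [Fin.val_ofNat, add_assoc (_ % _), Nat.mod_add_mod]; congr 1; omega
  · rintro ⟨⟨i, hi⟩, hc⟩ s k ⟨hk, hkn, hones, hor⟩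
    have hones' : ∀ j < k, unroll b (s + j) = true := hones
    have hzero : unroll b (s + k) = false := by
      rcases hor with rfl | ⟨-, h⟩
      · obtain ⟨j, hj, hj'⟩ := exists_unroll_in_window b false i s hi
        rw [hones' j hj] at hj'
        exact absurd hj' (by simp)
      · simpa [apply_cyclicShift b] using h
    have hz := hc s k hk hones' hzero
    have hex : ∃ m, unroll b (s + k + m) = true := by
      obtain ⟨j, -, hj'⟩ := exists_unroll_in_window b true s (s + k) (by simpa using hones' 0 hk)
      exact ⟨j, hj'⟩
    classical
    let m := Nat.find hex
    have hm : unroll b (s + k + m) = true := Nat.find_spec hex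
    have hlt : ∀ e < m, unroll b (s + k + e) = false := fun e he => by
      simpa using Nat.find_min hex he
    have hkm : k < m := by
      by_contra! hcon
      rw [hz m hcon] at hm
      exact absurd hm (by simp)
    refine ⟨m, hkm, by omega, ?_, ?_, Or.inr ⟨?_, ?_⟩⟩
    · obtain ⟨j, hj, hj'⟩ :=
        exists_unroll_in_window b true s (s + k) (by simpa using hones' 0 hk)
      exact (Nat.find_min' hex hj').trans hj.le
    · intro j hj
      rw [unroll_cyclicShift b, hlt j hj]
    · rw [unroll_cyclicShift b, ne_eq, Bool.not_eq_false, ← hones' (k - 1) (by omega),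
        ← unroll_add_self b (s + (k - 1))]
      congr 1; omega
    · rw [unroll_cyclicShift b, hm]; simp

/-! ### Cutting the circle into a linear word -/

/-- The automaton recognising linear words of blocks `1^a 0^b` with `1 ≤ a < b`: in state
`(true, k)` it has just read `k` ones, in state `(false, r)` it still requires `r` zeros. -/
def blockAccept : Bool → ℕ → List Bool → Bool
  | true, _, [] => false
  | true, k, true :: l => blockAccept true (k + 1) l
  | true, k, false :: l => blockAccept false k l
  | false, 0, [] => true
  | false, 0, true :: l => blockAccept true 1 l
  | false, 0, false :: l => blockAccept false 0 l
  | false, _ + 1, [] => false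
  | false, _ + 1, true :: _ => false
  | false, r + 1, false :: l => blockAccept false r l

/-- The part of `Constrained f` that concerns blocks of ones inside `[p, N)`. -/
def ConstrainedBetween (f : ℕ → Bool) (p N : ℕ) : Prop :=
  ∀ s k, p ≤ s → s + k < N → 1 ≤ k → (∀ j < k, f (s + j) = true) → f (s + k) = false →
    ∀ j ≤ k, f (s + k + j) = false

theorem constrainedBetween_of_false {f : ℕ → Bool} {p N : ℕ} (h : f p = false) :
    ConstrainedBetween f p N ↔ ConstrainedBetween f (p + 1) N := by
  constructor
  · exact fun H s k hs => H s k (by omega)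
  · intro H s k hs hN hk hones hz
    refine H s k ?_ hN hk hones hz
    rcases hs.lt_or_eq with h' | rfl
    · exact h'
    · have := hones 0 hk
      simp [h] at this

/-- A block of ones that starts inside this one and is followed by a zero is a suffix of it, so its
demand is weaker. -/
theorem constrainedBetween_of_block {f : ℕ → Bool} {q k N : ℕ} (hk : 1 ≤ k)
    (hN : q + k < N) (hones : ∀ j < k, f (q + j) = true) (hz : f (q + k) = false) :
    ConstrainedBetween f q N ↔
      (∀ j < k, f (q + k + 1 + j) = false) ∧ ConstrainedBetween f (q + k + 1) N := by
  constructor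
  · intro H
    refine ⟨fun j hj => ?_, fun s l hs => H s l (by omega)⟩
    rw [← H q k le_rfl hN hk hones hz (j + 1) (by omega)]; congr 1; omega
  · rintro ⟨h1, H⟩ s l hs hN' hl hones' hz' j hj
    by_cases hsq : q + k + 1 ≤ s
    · exact H s l hsq hN' hl hones' hz' j hj
    have h2 : s ≠ q + k := by
      rintro rfl
      have := hones' 0 hl
      simp [hz] at this
    have h3 : ¬ s + l < q + k := by
      intro h
      have := hones (s + l - q) (by omega)
      rw [show q + (s + l - q) = s + l by omega, hz'] at this
      exact absurd this (by simp)
    have h4 : ¬ q + k < s + l := by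
      intro h
      have := hones' (q + k - s) (by omega)
      rw [show s + (q + k - s) = q + k by omega, hz] at this
      exact absurd this (by simp)
    have h5 : s + l = q + k := by omega
    rw [h5]
    rcases j with _ | j
    · exact hz
    · rw [← h1 j (by omega)]; congr 1; omega

/-- Both states are treated in one induction. The one just past the word, where the circle closes,
makes an unfinished demand for zeros a genuine violation. -/
theorem blockAccept_ofFn_iff (f : ℕ → Bool) (m : ℕ) :
    (∀ q k, 1 ≤ k → f (q + k + m) = true → (∀ j < k, f (q + j) = true) →
      (blockAccept true k (List.ofFn fun i : Fin m => f (q + k + i)) = true ↔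
        f (q + k + m - 1) = false ∧ ConstrainedBetween f q (q + k + m))) ∧
    (∀ p r, f p = false → f (p + 1 + m) = true →
      (blockAccept false r (List.ofFn fun i : Fin m => f (p + 1 + i)) = true ↔
        (∀ j < r, f (p + 1 + j) = false) ∧ f (p + m) = false ∧
          ConstrainedBetween f (p + 1) (p + 1 + m))) := by
  induction m with
  | zero =>
    constructor
    · intro q k hk hN hones
      have := hones (k - 1) (by omega)
      rw [show q + (k - 1) = q + k - 1 by omega] at this
      simp [blockAccept, this]
    · intro p r hp hN
      rcases r with _ | r
      · simp only [List.ofFn_zero, blockAccept, true_iff]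
        exact ⟨by simp, hp, fun s k hs hs' => by omega⟩
      · simp only [List.ofFn_zero, blockAccept, Bool.false_eq_true, false_iff]
        intro h
        have := h.1 0 (by omega)
        simp_all
  | succ m ih =>
    obtain ⟨ih1, ih2⟩ := ih
    have shift : ∀ q : ℕ, (fun i : Fin m => f (q + (i.succ : Fin (m + 1)).val)) =
        fun i : Fin m => f (q + 1 + i) := by
      intro q; funext i; congr 1; simp; omega
    constructor
    · intro q k hk hN hones
      rw [List.ofFn_succ, shift]
      simp only [Fin.val_zero, add_zero]
      cases hf : f (q + k) with
      | true =>
        have := ih1 q (k + 1) (by omega) (by rw [← hN]; congr 1; omega) (fun j hj => by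
          rcases Nat.lt_succ_iff_lt_or_eq.1 hj with h | rfl
          · exact hones j h
          · exact hf)
        rw [← add_assoc] at this
        rw [blockAccept, this, show q + k + 1 + m = q + k + (m + 1) by omega]
      | false =>
        rw [blockAccept, ih2 (q + k) k hf (by rw [← hN]; congr 1; omega),
          constrainedBetween_of_block hk (by omega) hones hf]
        rw [show q + k + 1 + m = q + k + (m + 1) by omega,
          show q + k + (m + 1) - 1 = q + k + m by omega]
        tauto
    · intro p r hp hN
      rw [List.ofFn_succ, shift]
      simp only [Fin.val_zero, add_zero]
      cases hf : f (p + 1) with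
      | true =>
        rcases r with _ | r
        · rw [blockAccept, ih1 (p + 1) 1 le_rfl (by rw [← hN]; congr 1; omega) (fun j hj => by
            obtain rfl : j = 0 := by omega
            exact hf)]
          rw [show p + 1 + 1 + m = p + 1 + (m + 1) by omega,
            show p + 1 + (m + 1) - 1 = p + (m + 1) by omega]
          simp
        · simp only [blockAccept, Bool.false_eq_true, false_iff]
          intro h
          have := h.1 0 (by omega)
          simp_all
      | false =>
        have hN' : f (p + 1 + 1 + m) = true := by rw [← hN]; congr 1; omega
        rw [constrainedBetween_of_false hf]
        rcases r with _ | r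
        · rw [blockAccept, ih2 (p + 1) 0 hf hN', show p + 1 + m = p + (m + 1) by omega,
            show p + 1 + 1 + m = p + 1 + (m + 1) by omega]
          simp
        · rw [blockAccept, ih2 (p + 1) r hf hN', show p + 1 + m = p + (m + 1) by omega,
            show p + 1 + 1 + m = p + 1 + (m + 1) by omega]
          refine and_congr_left fun _ => ⟨fun h j hj => ?_, fun h j hj => ?_⟩
          · rcases j with _ | j
            · exact hf
            · rw [← h j (by omega)]; congr 1; omega
          · rw [← h (j + 1) (by omega)]; congr 1; omega

/-- The zero at `n - 1` keeps any block of ones from wrapping, so starts may be reduced modulo `n`.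
-/
theorem constrained_unroll_iff {n : ℕ} [NeZero n] (b : BinaryString n)
    (h : unroll b (n - 1) = false) :
    Constrained (unroll b) ↔ ConstrainedBetween (unroll b) 0 n := by
  have hn := NeZero.pos n
  constructor
  · exact fun H s k _ _ => H s k
  · intro H s k hk hones hz j hj
    have hmod : ∀ i, unroll b (s % n + i) = unroll b (s + i) := fun i =>
      unroll_congr b (by simp)
    rw [← add_zero (s + k), add_assoc, ← hmod] at hz
    rw [add_assoc, ← hmod, ← add_assoc]
    have hs := Nat.mod_lt s hn
    refine H (s % n) k (Nat.zero_le _) ?_ hk (fun j hj => by rw [hmod, hones j hj]) hz j hj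
    by_contra! hc
    have := hones (n - 1 - s % n) (by omega)
    rw [← hmod, show s % n + (n - 1 - s % n) = n - 1 by omega, h] at this
    exact absurd this (by simp)

theorem constrained_iff_blockAccept {m k : ℕ} (hk : 1 ≤ k) [NeZero (k + m)]
    (b : BinaryString (k + m)) (h : ∀ j < k, unroll b j = true) :
    (RunConstrainedCircularly b ∧ unroll b (k + m - 1) = false) ↔
      blockAccept true k (List.ofFn fun i : Fin m => unroll b (k + i)) = true := by
  have := (blockAccept_ofFn_iff (unroll b) m).1 0 k hk
    (by rw [← h 0 hk, zero_add, ← unroll_add_self b 0, zero_add]) (by simpa using h)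
  simp only [zero_add] at this
  rw [this, runConstrainedCircularly_iff]
  constructor
  · rintro ⟨⟨-, h1⟩, h2⟩
    exact ⟨h2, (constrained_unroll_iff b h2).1 h1⟩
  · rintro ⟨h2, h1⟩
    exact ⟨⟨⟨_, h2⟩, (constrained_unroll_iff b h2).2 h1⟩, h2⟩

/-! ### Counting accepted words -/

open Finset in
/-- The number of words of length `m` accepted from state `(c, k)`. -/
def acceptCount (c : Bool) (k m : ℕ) : ℕ :=
  #{w : Fin m → Bool | blockAccept c k (List.ofFn w) = true}

open Finset in
theorem card_filter_cons {m : ℕ} (p : (Fin (m + 1) → Bool) → Prop) [DecidablePred p] :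
    #{w | p w} = #{w : Fin m → Bool | p (Fin.cons true w)} +
      #{w : Fin m → Bool | p (Fin.cons false w)} := by
  simp only [Finset.card_filter]
  rw [← (Fin.consEquiv fun _ : Fin (m + 1) => Bool).sum_comp, Fintype.sum_prod_type,
    Fintype.sum_bool]
  rfl

theorem acceptCount_true_zero (k : ℕ) : acceptCount true k 0 = 0 := by
  simp [acceptCount, blockAccept]

theorem acceptCount_false_zero_zero : acceptCount false 0 0 = 1 := by
  simp [acceptCount, blockAccept]

theorem acceptCount_false_succ_zero (r : ℕ) : acceptCount false (r + 1) 0 = 0 := by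
  simp [acceptCount, blockAccept]

theorem acceptCount_true_succ (k m : ℕ) :
    acceptCount true k (m + 1) = acceptCount true (k + 1) m + acceptCount false k m := by
  simp only [acceptCount]
  rw [card_filter_cons]
  simp [blockAccept]

theorem acceptCount_false_zero_succ (m : ℕ) :
    acceptCount false 0 (m + 1) = acceptCount true 1 m + acceptCount false 0 m := by
  simp only [acceptCount]
  rw [card_filter_cons]
  simp [blockAccept]

theorem acceptCount_false_succ_succ (r m : ℕ) :
    acceptCount false (r + 1) (m + 1) = acceptCount false r m := by
  simp only [acceptCount]
  rw [card_filter_cons]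
  simp [blockAccept]

/-- One more initial one costs exactly one more zero in the first block. -/
theorem acceptCount_true_succ_succ (k m : ℕ) :
    acceptCount true (k + 1) (m + 1) = acceptCount true k m := by
  induction m generalizing k with
  | zero => simp [acceptCount_true_succ, acceptCount_true_zero, acceptCount_false_succ_zero]
  | succ m ih => rw [acceptCount_true_succ, ih, acceptCount_false_succ_succ, acceptCount_true_succ]

theorem acceptCount_fib_rec (m : ℕ) :
    acceptCount true 1 (m + 3) = acceptCount true 1 (m + 2) + acceptCount true 1 (m + 1) := by
  have h (j : ℕ) : acceptCount true 1 (j + 2) = acceptCount true 1 j + acceptCount false 0 j := by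
    rw [acceptCount_true_succ, acceptCount_true_succ_succ, acceptCount_false_succ_succ]
  rw [h (m + 1), h m, acceptCount_false_zero_succ]
  omega

theorem acceptCount_add_eq_lucasNumber (m : ℕ) :
    acceptCount true 1 (m + 3) + acceptCount true 1 (m + 1) = lucasNumber (m + 1) := by
  have h0 : acceptCount true 1 0 = 0 := acceptCount_true_zero 1
  have h1 : acceptCount true 1 1 = 0 := by
    rw [acceptCount_true_succ, acceptCount_true_zero, acceptCount_false_succ_zero]
  have h2 : acceptCount true 1 2 = 1 := by
    rw [acceptCount_true_succ, acceptCount_true_succ_succ, acceptCount_false_succ_succ, h0,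
      acceptCount_false_zero_zero]
  induction m using Nat.twoStepInduction with
  | zero => simp [acceptCount_fib_rec, h1, h2, lucasNumber]
  | one => simp [acceptCount_fib_rec, h1, h2, lucasNumber]
  | more m ih1 ih2 =>
    rw [lucasNumber, ← ih1, ← ih2, acceptCount_fib_rec (m + 2), acceptCount_fib_rec m]
    ring

/-! ### Counting valid circular strings up to rotation -/

open Finset in
open scoped Classical in
/-- The number of valid strings of length `n` whose periodic extension satisfies `P`. -/
noncomputable def validCount (n : ℕ) [NeZero n] (P : (ℕ → Bool) → Prop) : ℕ :=
  #{b : BinaryString n | RunConstrainedCircularly b ∧ P (unroll b)}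

theorem validCount_congr {n : ℕ} [NeZero n] {P Q : (ℕ → Bool) → Prop}
    (h : ∀ b : BinaryString n, P (unroll b) ↔ Q (unroll b)) : validCount n P = validCount n Q := by
  unfold validCount
  congr 1
  ext b
  simp [h]

theorem validCount_split {n : ℕ} [NeZero n] (P Q : (ℕ → Bool) → Prop) :
    validCount n P = validCount n (fun f => P f ∧ Q f) + validCount n (fun f => P f ∧ ¬ Q f) := by
  classical
  unfold validCount
  rw [← Finset.card_filter_add_card_filter_not fun b : BinaryString n => Q (unroll b)]
  simp only [Finset.filter_filter, and_assoc]

open Finset in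
/-- Valid strings of length `k + m` that start with `k` ones and end with a zero. -/
theorem validCount_starting_with_ones {k m : ℕ} (hk : 1 ≤ k) [NeZero (k + m)] :
    validCount (k + m) (fun f => (∀ j < k, f j = true) ∧ f (k + m - 1) = false) =
      acceptCount true k m := by
  classical
  have hofNat (j : ℕ) (hj : j < k + m) : Fin.ofNat (k + m) j = ⟨j, hj⟩ := by
    ext; simp [Nat.mod_eq_of_lt hj]
  have hnat (i : Fin m) : Fin.ofNat (k + m) (k + i) = Fin.natAdd k i := by
    rw [hofNat _ (by omega)]; rfl
  have hcast (j : ℕ) (hj : j < k) : Fin.ofNat (k + m) j = Fin.castAdd m ⟨j, hj⟩ := by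
    rw [hofNat _ (by omega)]; rfl
  refine Finset.card_nbij' (fun b i => b (Fin.natAdd k i)) (fun w => Fin.append (fun _ => true) w)
    ?_ ?_ ?_ ?_
  · intro b hb
    simp only [coe_filter, mem_univ, true_and, Set.mem_ofPred_eq] at hb ⊢
    have := (constrained_iff_blockAccept hk b hb.2.1).1 ⟨hb.1, hb.2.2⟩
    simpa only [unroll, hnat] using this
  · intro w hw
    simp only [coe_filter, mem_univ, true_and, Set.mem_ofPred_eq] at hw ⊢
    have h1 : ∀ j < k, unroll (Fin.append (fun _ : Fin k => true) w) j = true := by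
      intro j hj
      rw [unroll, hcast j hj, Fin.append_left]
    have := (constrained_iff_blockAccept hk _ h1).2
      (by simpa only [unroll, hnat, Fin.append_right] using hw)
    exact ⟨this.1, h1, this.2⟩
  · intro b hb
    simp only [coe_filter, mem_univ, true_and, Set.mem_ofPred_eq] at hb
    funext i
    refine Fin.addCases (fun j => ?_) (fun j => ?_) i
    · have := hb.2.1 j j.2
      rw [unroll, hcast j j.2] at this
      exact (Fin.append_left _ _ j).trans this.symm
    · exact Fin.append_right _ _ j
  · intro w _
    funext i
    simp

/-- Rotation of a circular string by `c` places. -/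
def rotate {n : ℕ} [NeZero n] (c : ℕ) : BinaryString n ≃ BinaryString n :=
  (Equiv.addRight (Fin.ofNat n c)).symm.arrowCongr (Equiv.refl Bool)

theorem unroll_rotate {n : ℕ} [NeZero n] (c : ℕ) (b : BinaryString n) (i : ℕ) :
    unroll (rotate c b) i = unroll b (i + c) := by
  simp only [unroll, rotate, Equiv.arrowCongr_apply, Function.comp, Equiv.refl_apply,
    Equiv.symm_symm, Equiv.coe_addRight]
  congr 1
  ext
  simp [Fin.val_add]

theorem constrained_shift_iff {n : ℕ} [NeZero n] (b : BinaryString n) (c : ℕ) :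
    (Constrained fun i => unroll b (i + c)) ↔ Constrained (unroll b) := by
  constructor
  · intro h s k hk hones hz j hj
    have hn := NeZero.pos n
    -- `(n - 1) * c` plays the role of `-c` modulo `n`.
    have key (i : ℕ) : unroll b (s + (n - 1) * c + i + c) = unroll b (s + i) := by
      apply unroll_congr
      have : s + (n - 1) * c + i + c = s + i + n * c := by
        obtain ⟨n, rfl⟩ : ∃ m, n = m + 1 := ⟨n - 1, by omega⟩
        simp only [Nat.add_sub_cancel]; ring
      rw [this, Nat.add_mul_mod_self_left]
    have := h (s + (n - 1) * c) k hk (fun j hj => by simpa only [key] using hones j hj)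
      (by simpa only [key] using hz) j hj
    rw [add_assoc (s + (n - 1) * c)] at this
    rw [add_assoc, ← key]
    exact this
  · intro h s k hk hones hz j hj
    have := h (s + c) k hk (fun j hj => by
      rw [← hones j hj, add_right_comm]) (by rw [← hz, add_right_comm]) j hj
    rw [← this]
    show unroll b (s + k + j + c) = _
    congr 1; omega

theorem runConstrainedCircularly_rotate {n : ℕ} [NeZero n] (c : ℕ) (b : BinaryString n) :
    RunConstrainedCircularly (rotate c b) ↔ RunConstrainedCircularly b := by
  rw [runConstrainedCircularly_iff, runConstrainedCircularly_iff]
  have h : unroll (rotate c b) = fun i => unroll b (i + c) := funext (unroll_rotate c b)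
  rw [h, constrained_shift_iff]
  refine and_congr_left fun _ => ⟨fun ⟨i, hi⟩ => ⟨_, hi⟩, fun ⟨i, hi⟩ => ?_⟩
  obtain ⟨j, -, hj⟩ := exists_unroll_in_window b false i c hi
  exact ⟨j, by rw [← hj, add_comm]⟩

open Finset in
theorem validCount_rotate {n : ℕ} [NeZero n] (c : ℕ) (P : (ℕ → Bool) → Prop) :
    validCount n (fun f => P fun i => f (i + c)) = validCount n P := by
  classical
  refine Finset.card_equiv (rotate c) fun b => ?_
  simp only [mem_filter, mem_univ, true_and, runConstrainedCircularly_rotate]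
  rw [show unroll (rotate c b) = fun i => unroll b (i + c) from funext (unroll_rotate c b)]

/-! ### Ones that can be cleared -/

/-- Turning the one at position `1` of a valid string into a zero keeps the string valid exactly
when that one is at an end of its run. -/
theorem runConstrainedCircularly_flip_one {n : ℕ} [NeZero n] (hn : 3 ≤ n)
    {b b' : BinaryString n} (hb : RunConstrainedCircularly b)
    (hb' : ∀ j, unroll b' j = if j % n = 1 then false else unroll b j) :
    RunConstrainedCircularly b' ↔ unroll b 0 = false ∨ unroll b 2 = false := by
  have m1 : 1 % n = 1 := Nat.mod_eq_of_lt (by omega)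
  have le (j : ℕ) (h : unroll b j = false) : unroll b' j = false := by simp [hb', h]
  have ge (j : ℕ) (h : unroll b' j = true) : unroll b j = true := by
    by_contra hc
    simp [le j (by simpa using hc)] at h
  rw [runConstrainedCircularly_iff] at hb ⊢
  obtain ⟨-, hb⟩ := hb
  constructor
  · rintro ⟨-, H⟩
    by_contra! hc
    simp only [ne_eq, Bool.not_eq_false] at hc
    have := H 0 1 le_rfl (fun j hj => by
      obtain rfl : j = 0 := by omega
      simp [hb', hc.1]) (by simp [hb', m1]) 1 le_rfl
    simp [hb', hc.2, Nat.mod_eq_of_lt (show 2 < n by omega)] at this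
  · intro hor
    refine ⟨⟨1, by simp [hb', m1]⟩, fun s k hk hones hz j hj => ?_⟩
    have hones' : ∀ j < k, unroll b (s + j) = true := fun j hj => ge _ (hones j hj)
    cases hf : unroll b (s + k) with
    | false => exact le _ (hb s k hk hones' hf j hj)
    | true =>
      -- The block ends at the cleared one, so in `b` it was one longer; that longer run already
      -- demanded enough zeros.
      have hsk : (s + k) % n = 1 := by
        by_contra hc
        rw [hb', if_neg hc, hf] at hz
        exact absurd hz (by simp)
      have h0 : unroll b 0 = true := by
        rw [← hones' (k - 1) (by omega)]
        apply unroll_congr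
        have := Nat.div_add_mod (s + k) n
        rw [show s + (k - 1) = 0 + n * ((s + k) / n) by omega, Nat.add_mul_mod_self_left]
      have h2 : unroll b (s + (k + 1)) = false := by
        rw [← hor.resolve_left (by simp [h0])]
        apply unroll_congr
        rw [← add_assoc, Nat.add_mod, hsk, m1]
      rcases j with _ | j
      · exact hz
      · have := hb s (k + 1) (by omega) (fun i hi => by
          rcases Nat.lt_succ_iff_lt_or_eq.1 hi with h | rfl
          · exact hones' i h
          · exact hf) h2 j (by omega)
        apply le
        rw [← this]; congr 1; omega

theorem validCount_run_end {n : ℕ} [NeZero n] (hn : 4 ≤ n) :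
    validCount n (fun f => f 1 = true ∧ (f 0 = false ∨ f 2 = false)) = lucasNumber (n - 3) := by
  have hX : validCount n (fun f => f 0 = false ∧ f 1 = true) = acceptCount true 1 (n - 1) := by
    obtain ⟨m, rfl⟩ : ∃ m, n = 1 + m := ⟨n - 1, by omega⟩
    rw [Nat.add_sub_cancel_left, ← validCount_starting_with_ones le_rfl,
      ← validCount_rotate 1 fun f => (∀ j < 1, f j = true) ∧ f (1 + m - 1) = false]
    refine validCount_congr fun b => ?_
    have : unroll b (1 + m - 1 + 1) = unroll b 0 := by
      rw [← unroll_add_self b 0]; congr 1; omega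
    simp only [this, Nat.lt_one_iff, forall_eq, zero_add]
    exact and_comm
  have hXX : validCount n (fun f => f 0 = false ∧ f 1 = true ∧ f 2 = true) =
      acceptCount true 1 (n - 3) := by
    obtain ⟨m, rfl⟩ : ∃ m, n = 1 + 1 + (m + 1) := ⟨n - 3, by omega⟩
    rw [show 1 + 1 + (m + 1) - 3 = m by omega, ← acceptCount_true_succ_succ,
      ← validCount_starting_with_ones (by norm_num),
      ← validCount_rotate 1 fun f => (∀ j < 1 + 1, f j = true) ∧ f (1 + 1 + (m + 1) - 1) = false]
    refine validCount_congr fun b => ?_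
    have h0 : unroll b (1 + 1 + (m + 1) - 1 + 1) = unroll b 0 := by
      rw [← unroll_add_self b 0]; congr 1; omega
    have h2 (p : ℕ → Prop) : (∀ j < 1 + 1, p j) ↔ p 0 ∧ p 1 :=
      ⟨fun h => ⟨h 0 (by omega), h 1 (by omega)⟩, fun h j hj => by
        interval_cases j
        exacts [h.1, h.2]⟩
    simp only [h0, h2, zero_add, Nat.reduceAdd]
    tauto
  -- Removing the pairs `11` from all ones, on either side, shows that run starts and run ends are
  -- equally numerous.
  have hrot := validCount_rotate (n := n) 1 fun f => f 0 = true ∧ f 1 = true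
  have split_zero := validCount_split (n := n) (fun f => f 1 = true) (fun f => f 0 = true)
  have split_two := validCount_split (n := n) (fun f => f 1 = true) (fun f => f 2 = true)
  rw [validCount_split (Q := fun f => f 2 = true),
    validCount_congr (Q := fun f => f 0 = false ∧ f 1 = true ∧ f 2 = true) (fun b => by
      cases h : unroll b 2 <;> simp [and_comm]), hXX,
    validCount_congr (P := fun f => _ ∧ ¬ _) (Q := fun f => f 1 = true ∧ ¬ f 2 = true) (fun b => by
      cases h : unroll b 2 <;> simp)]
  rw [validCount_congr (P := fun f => f 1 = true ∧ f 0 = true)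
      (Q := fun f => f 0 = true ∧ f 1 = true) (fun b => and_comm), ← hrot,
    validCount_congr (P := fun f => f 1 = true ∧ ¬ f 0 = true)
      (Q := fun f => f 0 = false ∧ f 1 = true) (fun b => by simp [and_comm]), hX] at split_zero
  simp only [zero_add, Nat.reduceAdd] at split_zero
  have L := acceptCount_add_eq_lucasNumber (n - 4)
  rw [show n - 4 + 3 = n - 1 by omega, show n - 4 + 1 = n - 3 by omega] at L
  omega

theorem unroll_update {n : ℕ} [NeZero n] (b : BinaryString n) (i : Fin n) (c : Bool) (j : ℕ) :
    unroll (Function.update b i c) j = if j % n = i then c else unroll b j := by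
  simp [unroll, Function.update_apply, Fin.ext_iff]

open Finset in
open scoped Classical in
theorem card_flippable {n : ℕ} [NeZero n] (hn : 4 ≤ n) (i : Fin n) :
    #{b : BinaryString n | RunConstrainedCircularly b ∧ b i = true ∧
      RunConstrainedCircularly (Function.update b i false)} = lucasNumber (n - 3) := by
  rw [← validCount_run_end hn]
  have hi := i.2
  have hmod : (1 + (i + (n - 1))) % n = i := by
    rw [show 1 + (i + (n - 1)) = i + n by omega, Nat.add_mod_right, Nat.mod_eq_of_lt hi]
  -- A shift by `i - 1` modulo `n` brings position `i` to position `1`.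
  refine Finset.card_equiv (rotate (i + (n - 1))) fun b => ?_
  simp only [mem_filter, mem_univ, true_and, runConstrainedCircularly_rotate]
  have h1 : unroll (rotate (i + (n - 1)) b) 1 = b i := by
    rw [unroll_rotate, ← unroll_mod, hmod, unroll_val]
  rw [h1]
  refine and_congr_right fun hb => and_congr_right fun hbi => ?_
  rw [← runConstrainedCircularly_rotate (i + (n - 1))]
  refine runConstrainedCircularly_flip_one (by omega)
    ((runConstrainedCircularly_rotate _ b).2 hb) fun j => ?_
  rw [unroll_rotate, unroll_rotate, unroll_update]
  have : (j + (i + (n - 1))) % n = i ↔ j % n = 1 := by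
    have m1 : 1 % n = 1 := Nat.mod_eq_of_lt (by omega)
    have : (j + (i + (n - 1))) ≡ 1 + (i + (n - 1)) [MOD n] ↔ j ≡ 1 [MOD n] :=
      Nat.ModEq.add_iff_right rfl
    simpa only [Nat.ModEq, hmod, m1] using this
  simp only [this]

/-! ### Edges as clearable ones -/

theorem hypercube_adj_iff {n : ℕ} (x y : BinaryString n) :
    (hypercube n).Adj x y ↔ ∃ i, y = Function.update x i (!x i) := by
  change hammingDist x y = 1 ↔ _
  rw [hammingDist, Finset.card_eq_one]
  refine exists_congr fun i => ⟨fun h => ?_, fun h => ?_⟩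
  · funext j
    have := congrArg (j ∈ ·) h
    by_cases hj : j = i
    · subst hj
      simp at this
      cases h1 : x j <;> cases h2 : y j <;> simp_all
    · simp [hj] at this
      simp [hj, this]
  · subst h
    ext j
    by_cases hj : j = i
    · subst hj; simp
    · simp [hj]

open Finset in
open scoped Classical in
theorem ncard_edgeSet_associatedMersenneGraph (n : ℕ) :
    (associatedMersenneGraph n).edgeSet.ncard = ∑ i : Fin n,
      #{b : BinaryString n | RunConstrainedCircularly b ∧ b i = true ∧
        RunConstrainedCircularly (Function.update b i false)} := by
  rw [← Finset.card_sigma, ← Set.ncard_coe_finset]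
  symm
  refine Set.ncard_congr (fun p hp => s(⟨p.2, ?_⟩, ⟨Function.update p.2 p.1 false, ?_⟩)) ?_ ?_ ?_
  · simp at hp; exact hp.1
  · simp at hp; exact hp.2.2
  · rintro ⟨i, b⟩ hp
    simp only [coe_sigma, coe_filter, mem_univ, true_and, Set.mem_sigma_iff, coe_univ,
      Set.mem_univ, Set.mem_ofPred_eq] at hp
    rw [SimpleGraph.mem_edgeSet]
    exact (hypercube_adj_iff _ _).2 ⟨i, by simp [hp.2.1]⟩
  · rintro ⟨i, b⟩ ⟨j, c⟩ hp hq h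
    simp only [coe_sigma, coe_filter, mem_univ, true_and, Set.mem_sigma_iff, coe_univ,
      Set.mem_univ, Set.mem_ofPred_eq] at hp hq
    have hbi := hp.2.1
    have hcj := hq.2.1
    simp only [Sym2.eq_iff, Subtype.mk.injEq] at h
    rcases h with ⟨rfl, h⟩ | ⟨h, h'⟩
    · have := congrFun h i
      by_cases hij : i = j
      · rw [hij]
      · simp [hij, hbi] at this
    -- Swapped endpoints are impossible: each string would arise from the other by clearing a one.
    · have h1 := congrFun h' j
      rw [hcj, h] at h1
      by_cases hij : i = j
      · simp [hij] at h1
      · simp [Ne.symm hij] at h1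
  · intro e
    induction e using Sym2.ind with
    | _ x y =>
      intro he
      rw [SimpleGraph.mem_edgeSet] at he
      obtain ⟨i, hi⟩ := (hypercube_adj_iff x.1 y.1).1 he
      cases hx : x.1 i with
      | true =>
        rw [hx] at hi
        refine ⟨⟨i, x.1⟩, ?_, ?_⟩
        · simpa [hx] using ⟨x.2, hi ▸ y.2⟩
        · simp only [Sym2.eq_iff]
          exact Or.inl ⟨trivial, Subtype.ext hi.symm⟩
      | false =>
        rw [hx] at hi
        have hy : Function.update y.1 i false = x.1 := by
          rw [hi, Function.update_idem, ← hx, Function.update_eq_self]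
        refine ⟨⟨i, y.1⟩, ?_, ?_⟩
        · simpa [hi ▸ Function.update_self i _ _] using
            (⟨y.2, by rw [hi]; simp, by rw [hy]; exact x.2⟩ : RunConstrainedCircularly y.1 ∧
              y.1 i = true ∧ RunConstrainedCircularly (Function.update y.1 i false))
        · simp only [Sym2.eq_iff]
          exact Or.inr ⟨trivial, Subtype.ext hy⟩

theorem theorem3p8 (n : ℕ) (hn : 4 ≤ n) :
    (associatedMersenneGraph n).edgeSet.ncard = n * lucasNumber (n - 3) := by
  have : NeZero n := ⟨by omega⟩
  rw [ncard_edgeSet_associatedMersenneGraph, Finset.sum_congr rfl fun i _ => card_flippable hn i]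
  simp
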